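/- Let $d$ be an odd prime, let $\mathcal S_n$ be the set of density operators on $(\mathbb C^d)^{\otimes n}$, and let $X|j\rangle=|j+1 \bmod d\rangle$, $Z|j\rangle=\omega^j|j\rangle$ with $\omega=e^{2\pi i/d}$. For $u=((a_1,b_1),\dots,(a_n,b_n))\in(\mathbb Z_d\times\mathbb Z_d)^n$ let $T_u=\bigotimes_{i}\omega^{-a_ib_i/2}Z^{a_i}X^{b_i}$ (with $1/2$ the inverse of $2$ modulo $d$) be the Heisenberg–Weyl operators, $A_0=d^{-n}\sum_u T_u$, $A_u=T_uA_0T_u^\dagger$, and let $W_\rho(u)=d^{-n}\operatorname{Tr}(A_u\rho)$ be the discrete Wigner function of $\rho\in\mathcal S_n$. The sum negativity of $\rho$ is $\operatorname{sn}(\rho)=\sum_{u:\,W_\rho(u)<0}|W_\rho(u)|$ and the mana of $\rho$ is $\mathscr M(\rho)=\log\sum_u|W_\rho(u)|$. A Clifford unitary is a unitary $U$ such that for every $u$ there are a real $\phi$ and a $u'$ with $UT_uU^\dagger=e^{i\phi}T_{u'}$; stabilizer states are the convex combinations of the states $U|0\rangle\langle0|U^\dagger$ with $U$ Clifford. A stabilizer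 protocol is a finite composition of: Clifford unitaries $\rho\mapsto U\rho U^\dagger$; composition $\rho\mapsto\rho\otimes S$ with a stabilizer state $S$; measurement of the final qudit in the computational basis (result $i$ with probability $\operatorname{Tr}(\rho\,V_i)$, after which the state is $V_i\rho V_i/\operatorname{Tr}(\rho\,V_i)$, where $V_i=\mathbb I\otimes|i\rangle\langle i|$); partial trace over the final qudit; and such operations conditioned on the outcomes of earlier measurements or on classical randomness (drawn from finite probability distributions). At its end the protocol announces a classical outcome $k$ from a finite set, which may retain all, some or none of the classical information gathered, and outputs a state $\sigma_k$ of $m_k$ qudits; thus, on input $\rho$, it outputs $\sigma_k$ with probability $p_k$, where $\sigma_k$ is the mixture of the final states of all runs that announce $k$. **Theorem (mana is an additive magic monotone).** 1. For all $n$, every $\rho\in\mathcal S_n$ and every stabilizer protocol that on input $\rho$ outputs $\sigma_k$ with probability $p_k$, one has $\sum_{k:\,p_k>0}p_k\,\mathscr M(\sigma_k)\le\mathscr M(\rho)$. 2. For all $n$ and $\rho\in\mathcal S_n$, $\mathscr M(\rho)=\log(2\operatorname{sn}(\rho)+1)$. 3. For all $n,m$, $\rho\in\mathcal S_n$ and $\sigma\in\mathcal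 S_m$, $\mathscr M(\rho\otimes\sigma)=\mathscr M(\rho)+\mathscr M(\sigma)$. -/

import Mathlib

open scoped ComplexOrder Kronecker Matrix

noncomputable section

/-- Operators on the Hilbert space `(ℂ^d)^{⊗ n}` of `n` qudits, as matrices in the computational
basis; the basis vectors are labelled by the strings in `(ℤ/d)^n`. -/
abbrev QOp (d n : ℕ) : Type := Matrix (Fin n → ZMod d) (Fin n → ZMod d) ℂ

/-- The discrete phase space `(ℤ/d × ℤ/d)^n`. -/
abbrev PhaseSpace (d n : ℕ) : Type := Fin n → ZMod d × ZMod d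

section Defs

variable (d : ℕ) [NeZero d]

/-- The shift operator `X |j⟩ = |j + 1⟩`. -/
def shiftX : Matrix (ZMod d) (ZMod d) ℂ :=
  Matrix.of fun i j => if i = j + 1 then 1 else 0

/-- The boost operator `Z |j⟩ = ω^j |j⟩` with `ω = exp (2πi/d)`; `ZMod.stdAddChar c` is `ω^c`. -/
def boostZ : Matrix (ZMod d) (ZMod d) ℂ :=
  Matrix.diagonal fun j => ZMod.stdAddChar j

variable {d}

/-- The one-qudit Heisenberg-Weyl operator `T_(a₁,a₂) = ω^(-a₁a₂/2) Z^a₁ X^a₂` (for odd `d`, where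
`1/2` is the inverse of `2` modulo `d`). -/
def hw1 (a : ZMod d × ZMod d) : Matrix (ZMod d) (ZMod d) ℂ :=
  (ZMod.stdAddChar (-(a.1 * a.2 * 2⁻¹)) : ℂ) • (boostZ d ^ a.1.val * shiftX d ^ a.2.val)

/-- The `n`-qudit Heisenberg-Weyl operator `T_u = T_{u_1} ⊗ ⋯ ⊗ T_{u_n}`. -/
def hw {n : ℕ} (u : PhaseSpace d n) : QOp d n :=
  Matrix.of fun x y => ∏ i, hw1 (u i) (x i) (y i)

/-- Clifford unitaries: unitaries that map every Heisenberg-Weyl operator, up to a phase, to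
a Heisenberg-Weyl operator under conjugation. -/
def IsClifford {n : ℕ} (U : QOp d n) : Prop :=
  U ∈ Matrix.unitaryGroup (Fin n → ZMod d) ℂ ∧
    ∀ u : PhaseSpace d n, ∃ (φ : ℝ) (u' : PhaseSpace d n),
      U * hw u * Uᴴ = Complex.exp (Complex.I * φ) • hw u'

/-- The pure stabilizer states `U|0⟩⟨0|U†`, `U` Clifford. -/
def pureStab (d : ℕ) [NeZero d] (n : ℕ) : Set (QOp d n) :=
  {S | ∃ U : QOp d n, IsClifford U ∧ S = U * Matrix.single 0 0 1 * Uᴴ}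

/-- The stabilizer states: convex combinations of pure stabilizer states. -/
def STAB (d : ℕ) [NeZero d] (n : ℕ) : Set (QOp d n) :=
  convexHull ℝ (pureStab d n)

/-- Being a density operator: positive semidefinite with trace one. -/
def IsDensity {n : ℕ} (ρ : QOp d n) : Prop := ρ.PosSemidef ∧ ρ.trace = 1

/-- The set `𝒮(ℋ_{d^n})` of density operators (quantum states) of `n` qudits. -/
def QState (d : ℕ) [NeZero d] (n : ℕ) : Type := {ρ : QOp d n // IsDensity ρ}

/-- The tensor product of an operator on `n` qudits and an operator on `m` qudits. -/
def tensorOp {n m : ℕ} (ρ : QOp d n) (σ : QOp d m) : QOp d (n + m) :=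
  Matrix.reindex (Fin.appendEquiv n m) (Fin.appendEquiv n m) (ρ ⊗ₖ σ)

theorem IsDensity.tensor {n m : ℕ} {ρ : QOp d n} {σ : QOp d m} (hρ : IsDensity ρ)
    (hσ : IsDensity σ) : IsDensity (tensorOp ρ σ) := by
  refine ⟨(hρ.1.kronecker hσ.1).submatrix _, ?_⟩
  have h : (tensorOp ρ σ).trace = (ρ ⊗ₖ σ).trace := by
    simp only [tensorOp, Matrix.trace, Matrix.diag_apply, Matrix.reindex_apply,
      Matrix.submatrix_apply]
    exact Equiv.sum_comp (Fin.appendEquiv n m).symm fun p => (ρ ⊗ₖ σ) p p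
  rw [h, Matrix.trace_kronecker, hρ.2, hσ.2, one_mul]

theorem posSemidef_of_mem_STAB {n : ℕ} {S : QOp d n} (hS : S ∈ STAB d n) : S.PosSemidef := by
  have hc : Convex ℝ {A : QOp d n | A.PosSemidef} := by
    intro A hA B hB a b ha hb _
    exact (hA.smul ha).add (hB.smul hb)
  refine convexHull_min ?_ hc hS
  rintro _ ⟨U, _, rfl⟩
  refine Matrix.PosSemidef.mul_mul_conjTranspose_same ?_ U
  have : (Matrix.single 0 0 1 : QOp d n) = Matrix.diagonal (Pi.single 0 1) :=
    (Matrix.diagonal_single 0 1).symm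
  rw [this]
  exact Matrix.PosSemidef.diagonal (by
    intro x
    by_cases h : x = 0 <;> simp [h])

/-- The tensor product of two states. -/
def QState.tensor {n m : ℕ} (ρ : QState d n) (σ : QState d m) : QState d (n + m) :=
  ⟨tensorOp ρ.1 σ.1, ρ.2.tensor σ.2⟩

/-- The projector `𝕀 ⊗ |i⟩⟨i|`, with `|i⟩⟨i|` acting on the final qudit. -/
def lastProj {n : ℕ} (i : ZMod d) : QOp d (n + 1) :=
  Matrix.diagonal fun x => if x (Fin.last n) = i then 1 else 0

/-- The partial trace over the final qudit. -/
def traceLast {n : ℕ} (ρ : QOp d (n + 1)) : QOp d n :=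
  Matrix.of fun x y => ∑ i : ZMod d,
    ρ (Fin.snoc (α := fun _ => ZMod d) x i) (Fin.snoc (α := fun _ => ZMod d) y i)

/-! ### Stabilizer protocols -/

/-- A stabilizer protocol on `n` qudits, as a finite tree of elementary operations. Whatever follows
a computational basis measurement of the final qudit, or the drawing of a classical random number,
may depend on its outcome. Every leaf announces a classical outcome `k : Fin r` and outputs the
`m k` qudits that are left. Different leaves may announce the same `k`: then
the protocol forgets which of them was reached, and outputs the mixture. -/
inductive StabProtocol (d : ℕ) [NeZero d] {r : ℕ} (m : Fin r → ℕ) : ℕ → Type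
  | out (k : Fin r) : StabProtocol d m (m k)
  | clifford {n : ℕ} (U : QOp d n) (hU : IsClifford U)
      (next : StabProtocol d m n) : StabProtocol d m n
  | append {n l : ℕ} (S : QOp d l) (hS : S ∈ STAB d l)
      (next : StabProtocol d m (n + l)) : StabProtocol d m n
  | measure {n : ℕ} (next : ZMod d → StabProtocol d m (n + 1)) : StabProtocol d m (n + 1)
  | discard {n : ℕ} (next : StabProtocol d m n) : StabProtocol d m (n + 1)
  | random {n s : ℕ} (w : Fin s → ℝ) (w_nonneg : ∀ j, 0 ≤ w j) (w_sum : ∑ j, w j = 1)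
      (next : Fin s → StabProtocol d m n) : StabProtocol d m n

namespace StabProtocol

variable {r : ℕ} {m : Fin r → ℕ}

/-- The subnormalized output of the protocol for the outcome `k`: its trace is the probability `p_k`
of the outcome `k` on the input `ρ`, and it is `p_k` times the output state given `k`.
(A measurement has the result `i` with probability `Tr (ρ V_i)`, `V_i = 𝕀 ⊗ |i⟩⟨i|`, and then
leaves `V_i ρ V_i / Tr (ρ V_i)`; the product of the two is `V_i ρ V_i`.) -/
def branch : {n : ℕ} → StabProtocol d m n → QOp d n → (k : Fin r) → QOp d (m k)
  | _, out l, ρ, k => if h : l = k then h ▸ ρ else 0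
  | _, clifford U _ next, ρ, k => next.branch (U * ρ * Uᴴ) k
  | _, append S _ next, ρ, k => next.branch (tensorOp ρ S) k
  | _, measure next, ρ, k => ∑ i, (next i).branch (lastProj i * ρ * lastProj i) k
  | _, discard next, ρ, k => next.branch (traceLast ρ) k
  | _, random w _ _ next, ρ, k => ∑ j, (w j : ℂ) • (next j).branch ρ k

/-- The probability `p_k` of the outcome `k` on the input `ρ`. -/
def prob {n : ℕ} (Λ : StabProtocol d m n) (ρ : QState d n) (k : Fin r) : ℝ :=
  (Λ.branch ρ.1 k).trace.re

theorem posSemidef_branch {n : ℕ} (Λ : StabProtocol d m n) (ρ : QOp d n) (hρ : ρ.PosSemidef)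
    (k : Fin r) : (Λ.branch ρ k).PosSemidef := by
  induction Λ with
  | out l =>
    unfold branch
    split_ifs with h
    · subst h
      exact hρ
    · exact Matrix.PosSemidef.zero
  | clifford U _ next ih => exact ih _ (hρ.mul_mul_conjTranspose_same U)
  | append S hS next ih => exact ih _ ((hρ.kronecker (posSemidef_of_mem_STAB hS)).submatrix _)
  | @measure n' next ih =>
    refine Matrix.posSemidef_sum _ fun i _ => ih i _ ?_
    have h : (lastProj i : QOp d (n' + 1))ᴴ = lastProj i := by
      unfold lastProj
      rw [Matrix.diagonal_conjTranspose]
      congr 1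
      funext x
      by_cases h : x (Fin.last _) = i <;> simp [h]
    have := hρ.mul_mul_conjTranspose_same (lastProj i)
    rwa [h] at this
  | discard next ih =>
    refine ih _ ?_
    have h : traceLast ρ = ∑ i : ZMod d, ρ.submatrix
        (fun x => Fin.snoc (α := fun _ => ZMod d) x i)
        (fun x => Fin.snoc (α := fun _ => ZMod d) x i) := by
      ext x y
      simp [traceLast, Matrix.sum_apply]
    rw [h]
    exact Matrix.posSemidef_sum _ fun i _ => hρ.submatrix _
  | random w w_nonneg _ next ih =>
    exact Matrix.posSemidef_sum _ fun j _ =>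
      (ih j _ hρ).smul (by exact_mod_cast w_nonneg j)

/-- The output state `σ_k` for an outcome `k` of positive probability. -/
def outState {n : ℕ} (Λ : StabProtocol d m n) (ρ : QState d n) (k : Fin r)
    (hk : 0 < Λ.prob ρ k) : QState d (m k) :=
  ⟨(((Λ.prob ρ k)⁻¹ : ℝ) : ℂ) • Λ.branch ρ.1 k, by
    have hp := Λ.posSemidef_branch ρ.1 ρ.2.1 k
    refine ⟨hp.smul (by exact_mod_cast (inv_pos.2 hk).le), ?_⟩
    have h : (Λ.branch ρ.1 k).trace = (Λ.prob ρ k : ℂ) := by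
      apply Complex.ext
      · simp [prob]
      · simpa using (Complex.le_def.1 hp.trace_nonneg).2.symm
    rw [Matrix.trace_smul, h, smul_eq_mul, ← Complex.ofReal_mul, inv_mul_cancel₀ hk.ne',
      Complex.ofReal_one]⟩

/-- The average `∑ k, p_k M(σ_k)` of a function `M` of states over the output of a protocol, on
the input `ρ`. -/
def average (M : ∀ n, QState d n → ℝ) {n : ℕ} (Λ : StabProtocol d m n) (ρ : QState d n) : ℝ :=
  ∑ k, if hk : 0 < Λ.prob ρ k then Λ.prob ρ k * M (m k) (Λ.outState ρ k hk) else 0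

end StabProtocol

/-- A magic monotone is a real-valued function of quantum states that does not increase on average
under stabilizer protocols. -/
def IsMagicMonotone (M : ∀ n, QState d n → ℝ) : Prop :=
  ∀ (n r : ℕ) (m : Fin r → ℕ) (Λ : StabProtocol d m n) (ρ : QState d n),
    Λ.average M ρ ≤ M n ρ

/-! ### Wigner function, sum negativity, mana -/

/-- The phase space point operator at the origin, `A_0 = d^{-n} ∑ u, T_u`. -/
def pointOpZero (d : ℕ) [NeZero d] (n : ℕ) : QOp d n :=
  ((d : ℂ) ^ n)⁻¹ • ∑ u : PhaseSpace d n, hw u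

/-- The phase space point operators `A_u = T_u A_0 T_u†`. -/
def pointOp {n : ℕ} (u : PhaseSpace d n) : QOp d n :=
  hw u * pointOpZero d n * (hw u)ᴴ

/-- The discrete Wigner function `W_ρ(u) = d^{-n} Tr (A_u ρ)`. The trace is real, since `A_u` (for
odd `d`) and `ρ` are Hermitian. -/
def wigner {n : ℕ} (ρ : QState d n) (u : PhaseSpace d n) : ℝ :=
  ((d : ℝ) ^ n)⁻¹ * (pointOp u * ρ.1).trace.re

/-- The sum negativity: the sum of `|W_ρ(u)|` over the points `u` where `W_ρ(u) < 0`. -/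
def sumNegativity {n : ℕ} (ρ : QState d n) : ℝ :=
  ∑ u : PhaseSpace d n, if wigner ρ u < 0 then |wigner ρ u| else 0

/-- The mana `𝓜(ρ) = log (∑ u, |W_ρ(u)|)`. -/
def mana (n : ℕ) (ρ : QState d n) : ℝ :=
  Real.log (∑ u : PhaseSpace d n, |wigner ρ u|)

end Defs

end

/-! Everything rests on the `ℓ¹`-norm of the Wigner function, extended from states to all operators
as `wignerNorm`, so that unnormalized branches of a protocol can be treated directly. Oddness of `d`
enters only through the invertibility of 2.

Each elementary operation is harmless to this norm. Clifford unitaries permute the phase space point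
operators (`IsClifford.exists_perm`). Point operators factor over tensor products, so the norm is
multiplicative, and it is at most 1 on stabilizer states. Discarding a qudit takes a marginal of the
Wigner function. Measuring one replaces the function by its averages along lines, with different
lines for different outcomes. Induction on the protocol tree gives
`StabProtocol.sum_wignerNorm_branch_le`: the branch norms add up to at most the input norm.

This passes to logarithms through `log x ≤ x - 1`, applied to the ratio of the norms of `σ_k` and
`ρ` and averaged with weights `p_k`. The formula with sum negativity holds because a Wigner function
sums to 1, and additivity is the logarithm of multiplicativity. -/

/-! ### Heisenberg–Weyl calculus and phase space point operators -/

section Weyl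

set_option linter.unusedSectionVars false

variable {d : ℕ} [Fact d.Prime]

local notation "𝕖" => (ZMod.stdAddChar : AddChar (ZMod d) ℂ)

theorem ZMod.two_ne_zero_of_odd (hd : Odd d) : (2 : ZMod d) ≠ 0 := by
  intro h
  have h' : ((2 : ℕ) : ZMod d) = 0 := by exact_mod_cast h
  rw [ZMod.natCast_eq_zero_iff] at h'
  have h2 := (Nat.prime_dvd_prime_iff_eq (Fact.out : d.Prime) Nat.prime_two).1 h'
  subst h2
  exact absurd hd (by decide)

theorem conj_stdAddChar (x : ZMod d) : star (𝕖 x) = 𝕖 (-x) :=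
  (AddChar.map_neg_eq_conj _ _).symm

theorem norm_stdAddChar (x : ZMod d) : ‖𝕖 x‖ = 1 :=
  AddChar.norm_apply _ _

theorem sum_stdAddChar_mul (b : ZMod d) : ∑ x, 𝕖 (x * b) = if b = 0 then (d : ℂ) else 0 := by
  rw [AddChar.sum_mulShift b (ZMod.isPrimitive_stdAddChar d), ZMod.card]
  split_ifs <;> simp

theorem map_sum_stdAddChar {ι : Type*} (s : Finset ι) (f : ι → ZMod d) :
    𝕖 (∑ i ∈ s, f i) = ∏ i ∈ s, 𝕖 (f i) := by
  classical
  induction s using Finset.induction_on with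
  | empty => simp
  | insert i s hi ih => rw [Finset.sum_insert hi, Finset.prod_insert hi, AddChar.map_add_eq_mul, ih]

theorem shiftX_pow_apply (k : ℕ) (x y : ZMod d) :
    (shiftX d ^ k) x y = if x = y + k then 1 else 0 := by
  induction k generalizing x with
  | zero => simp [Matrix.one_apply]
  | succ k ih =>
    rw [pow_succ', Matrix.mul_apply]
    have h (j : ZMod d) : shiftX d x j = if x - 1 = j then 1 else 0 := by
      simp only [shiftX, Matrix.of_apply, sub_eq_iff_eq_add]
    simp only [h, ih, ite_mul, one_mul, zero_mul, Finset.sum_ite_eq, Finset.mem_univ, if_true]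
    simp only [sub_eq_iff_eq_add, Nat.cast_succ, add_assoc]

theorem hw1_apply (a : ZMod d × ZMod d) (x y : ZMod d) :
    hw1 a x y = if x = y + a.2 then 𝕖 (a.1 * x - a.1 * a.2 * 2⁻¹) else 0 := by
  have h : (boostZ d ^ a.1.val * shiftX d ^ a.2.val) x y
      = 𝕖 (a.1 * x) * if x = y + a.2 then 1 else 0 := by
    rw [boostZ, Matrix.diagonal_pow, Matrix.diagonal_mul, shiftX_pow_apply, ZMod.natCast_zmod_val,
      Pi.pow_apply, ← AddChar.map_nsmul_eq_pow, nsmul_eq_mul, ZMod.natCast_zmod_val]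
  rw [hw1, Matrix.smul_apply, h, smul_eq_mul]
  split_ifs
  · rw [mul_one, ← AddChar.map_add_eq_mul]
    congr 1
    ring
  · simp

/-- The phase `ω^(-ab/2)` built into `hw1` is what makes the cocycle exactly half the symplectic
form. -/
theorem hw1_mul (u v : ZMod d × ZMod d) (h2 : (2 : ZMod d) ≠ 0) :
    hw1 u * hw1 v = 𝕖 (2⁻¹ * (u.1 * v.2 - u.2 * v.1)) • hw1 (u + v) := by
  ext x z
  rw [Matrix.mul_apply, Finset.sum_eq_single (x - u.2)]
  · simp only [Matrix.smul_apply, hw1_apply, smul_eq_mul, sub_add_cancel, if_true, Prod.fst_add,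
      Prod.snd_add]
    by_cases h : x - u.2 = z + v.2
    · have h' : x = z + (u.2 + v.2) := by linear_combination h
      rw [if_pos h, if_pos h', ← AddChar.map_add_eq_mul, ← AddChar.map_add_eq_mul]
      congr 1
      field_simp
      ring
    · have h' : ¬ x = z + (u.2 + v.2) := fun h' => h (by linear_combination h')
      rw [if_neg h, if_neg h', mul_zero, mul_zero]
  · intro y _ hy
    rw [hw1_apply, if_neg, zero_mul]
    intro h
    exact hy (by linear_combination -h)
  · simp

theorem hw1_conjTranspose (u : ZMod d × ZMod d) (h2 : (2 : ZMod d) ≠ 0) :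
    (hw1 u)ᴴ = hw1 (-u) := by
  ext x y
  rw [Matrix.conjTranspose_apply, hw1_apply, hw1_apply]
  by_cases h : y = x + u.2
  · have h' : x = y + (-u).2 := by rw [h]; simp
    rw [if_pos h, if_pos h', conj_stdAddChar, h]
    congr 1
    simp only [Prod.fst_neg, Prod.snd_neg]
    field_simp
    ring
  · have h' : ¬ x = y + (-u).2 := fun h' => h (by rw [h']; simp)
    rw [if_neg h, if_neg h', star_zero]

theorem hw1_zero : hw1 (0 : ZMod d × ZMod d) = 1 := by
  ext x y
  rw [hw1_apply]
  simp [Matrix.one_apply]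

/-- The tensor product of a family of one-qudit operators. -/
noncomputable def siteProd {n : ℕ} (A : Fin n → Matrix (ZMod d) (ZMod d) ℂ) : QOp d n :=
  Matrix.of fun x y => ∏ i, A i (x i) (y i)

theorem siteProd_mul {n : ℕ} (A B : Fin n → Matrix (ZMod d) (ZMod d) ℂ) :
    siteProd A * siteProd B = siteProd fun i => A i * B i := by
  ext x z
  simp only [siteProd, Matrix.mul_apply, Matrix.of_apply, ← Finset.prod_mul_distrib]
  exact (Fintype.prod_sum fun i y => A i (x i) y * B i y (z i)).symm

theorem siteProd_smul {n : ℕ} (c : Fin n → ℂ) (A : Fin n → Matrix (ZMod d) (ZMod d) ℂ) :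
    (siteProd fun i => c i • A i) = (∏ i, c i) • siteProd A := by
  ext x y
  simp [siteProd, Finset.prod_mul_distrib]

theorem siteProd_conjTranspose {n : ℕ} (A : Fin n → Matrix (ZMod d) (ZMod d) ℂ) :
    (siteProd A)ᴴ = siteProd fun i => (A i)ᴴ := by
  ext x y
  simp [siteProd, Matrix.conjTranspose_apply]

theorem sum_siteProd {n : ℕ} {κ : Type*} [Fintype κ]
    (A : κ → Matrix (ZMod d) (ZMod d) ℂ) :
    ∑ u : Fin n → κ, (siteProd fun i => A (u i)) = siteProd fun _ => ∑ a, A a := by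
  ext x y
  simp only [siteProd, Matrix.sum_apply, Matrix.of_apply]
  exact (Fintype.prod_sum fun i a => A a (x i) (y i)).symm

theorem siteProd_one {n : ℕ} : siteProd (fun _ : Fin n => (1 : Matrix (ZMod d) (ZMod d) ℂ)) = 1 := by
  ext x y
  simp only [siteProd, Matrix.of_apply, Matrix.one_apply]
  rw [Finset.prod_ite_zero]
  simp [funext_iff]

theorem hw_eq_siteProd {n : ℕ} (u : PhaseSpace d n) : hw u = siteProd fun i => hw1 (u i) := rfl

/-- The symplectic form on phase space. -/
def symplForm {n : ℕ} (u v : PhaseSpace d n) : ZMod d :=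
  ∑ i, ((u i).1 * (v i).2 - (u i).2 * (v i).1)

theorem symplForm_swap {n : ℕ} (u v : PhaseSpace d n) : symplForm v u = -symplForm u v := by
  rw [symplForm, symplForm, ← Finset.sum_neg_distrib]
  exact Finset.sum_congr rfl fun i _ => by ring

theorem symplForm_add_right {n : ℕ} (u v w : PhaseSpace d n) :
    symplForm u (v + w) = symplForm u v + symplForm u w := by
  rw [symplForm, symplForm, symplForm, ← Finset.sum_add_distrib]
  exact Finset.sum_congr rfl fun i _ => by simp only [Pi.add_apply, Prod.fst_add, Prod.snd_add]; ring

theorem symplForm_add_left {n : ℕ} (u v w : PhaseSpace d n) :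
    symplForm (u + v) w = symplForm u w + symplForm v w := by
  rw [← neg_inj, ← symplForm_swap, symplForm_add_right, symplForm_swap u w, symplForm_swap v w]
  ring

theorem symplForm_nondegenerate {n : ℕ} {u : PhaseSpace d n} (h : ∀ v, symplForm u v = 0) :
    u = 0 := by
  funext i
  have key (p : ZMod d × ZMod d) :
      symplForm u (Pi.single i p) = (u i).1 * p.2 - (u i).2 * p.1 := by
    rw [symplForm, Finset.sum_eq_single i]
    · simp
    · intro j _ hj
      simp [Pi.single_eq_of_ne hj]
    · simp
  refine Prod.ext ?_ ?_
  · simpa [key] using h (Pi.single i (0, 1))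
  · simpa [key] using h (Pi.single i (1, 0))

theorem hw_mul {n : ℕ} (u v : PhaseSpace d n) (h2 : (2 : ZMod d) ≠ 0) :
    hw u * hw v = 𝕖 (2⁻¹ * symplForm u v) • hw (u + v) := by
  rw [hw_eq_siteProd, hw_eq_siteProd, hw_eq_siteProd, siteProd_mul]
  simp only [hw1_mul _ _ h2]
  rw [siteProd_smul, symplForm, Finset.mul_sum, map_sum_stdAddChar]
  rfl

theorem hw_conjTranspose {n : ℕ} (u : PhaseSpace d n) (h2 : (2 : ZMod d) ≠ 0) :
    (hw u)ᴴ = hw (-u) := by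
  rw [hw_eq_siteProd, hw_eq_siteProd, siteProd_conjTranspose]
  simp only [hw1_conjTranspose _ h2]
  rfl

theorem hw_zero {n : ℕ} : hw (0 : PhaseSpace d n) = 1 := by
  rw [hw_eq_siteProd, ← siteProd_one]
  simp only [Pi.zero_apply, hw1_zero]

theorem hw_mul_conjTranspose {n : ℕ} (u : PhaseSpace d n) (h2 : (2 : ZMod d) ≠ 0) :
    hw u * (hw u)ᴴ = 1 := by
  have h : symplForm u (-u) = 0 :=
    Finset.sum_eq_zero fun i _ => by simp only [Pi.neg_apply, Prod.fst_neg, Prod.snd_neg]; ring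
  rw [hw_conjTranspose u h2, hw_mul _ _ h2, h, mul_zero, AddChar.map_zero_eq_one, one_smul,
    add_neg_cancel, hw_zero]

theorem hw_mul_comm {n : ℕ} (u v : PhaseSpace d n) (h2 : (2 : ZMod d) ≠ 0) :
    hw u * hw v = 𝕖 (symplForm u v) • (hw v * hw u) := by
  rw [hw_mul _ _ h2, hw_mul _ _ h2, smul_smul, ← AddChar.map_add_eq_mul, symplForm_swap u v,
    add_comm v u]
  congr 2
  field_simp
  ring

theorem hw_conj_hw {n : ℕ} (u v : PhaseSpace d n) (h2 : (2 : ZMod d) ≠ 0) :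
    hw u * hw v * (hw u)ᴴ = 𝕖 (symplForm u v) • hw v := by
  rw [hw_mul_comm _ _ h2, Matrix.smul_mul, Matrix.mul_assoc, hw_mul_conjTranspose _ h2,
    Matrix.mul_one]

theorem hw_ne_zero {n : ℕ} (u : PhaseSpace d n) (h2 : (2 : ZMod d) ≠ 0) : hw u ≠ 0 := by
  intro h
  have := hw_mul_conjTranspose u h2
  rw [h, Matrix.zero_mul] at this
  exact zero_ne_one this

/-- Heisenberg-Weyl operators that agree up to a nonzero scalar are equal. -/
theorem smul_hw_inj {n : ℕ} {u v : PhaseSpace d n} {α β : ℂ} (h2 : (2 : ZMod d) ≠ 0) (hα : α ≠ 0)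
    (h : α • hw u = β • hw v) : u = v ∧ α = β := by
  have huv : u = v := by
    rw [← sub_eq_zero]
    refine symplForm_nondegenerate fun w => ?_
    -- Commuting past `hw w` yields `ω^[u,w]` or `ω^[v,w]`, depending on which expression for the
    -- operator is used. Since `ω^·` is injective, `u - v` is symplectically orthogonal to every
    -- `w`.
    have h1 : α • hw u * hw w = (α * 𝕖 (symplForm u w)) • (hw w * hw u) := by
      rw [Matrix.smul_mul, hw_mul_comm _ _ h2, smul_smul]
    have h3 : α • hw u * hw w = (α * 𝕖 (symplForm v w)) • (hw w * hw u) := by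
      rw [h, Matrix.smul_mul, hw_mul_comm _ _ h2, smul_comm, ← Matrix.mul_smul, ← h,
        Matrix.mul_smul, smul_smul, mul_comm]
    have hne : hw w * hw u ≠ 0 := by
      rw [hw_mul _ _ h2]
      exact smul_ne_zero (norm_ne_zero_iff.1 (by rw [norm_stdAddChar]; exact one_ne_zero))
        (hw_ne_zero _ h2)
    have h4 := mul_left_cancel₀ hα (smul_left_injective ℂ hne (h1.symm.trans h3))
    have h5 := ZMod.injective_stdAddChar h4
    have h6 := symplForm_add_left (u - v) v w
    rw [sub_add_cancel] at h6
    linear_combination h5 - h6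
  subst huv
  exact ⟨rfl, smul_left_injective ℂ (hw_ne_zero u h2) h⟩

/-- The one-qudit phase space point operator, by its entries. -/
noncomputable def pointOp1 (a : ZMod d × ZMod d) : Matrix (ZMod d) (ZMod d) ℂ :=
  Matrix.of fun x y => if x + y = 2 * a.2 then 𝕖 (a.1 * (x - y)) else 0

theorem pointOp1_apply (a : ZMod d × ZMod d) (x y : ZMod d) :
    pointOp1 a x y = if x + y = 2 * a.2 then 𝕖 (a.1 * (x - y)) else 0 := rfl

/-- In the entry `(x, y)` only the shift `b = x - y` survives; the remaining character sum forces `x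
+ y = 0`. So `A_0` is the parity operator. -/
theorem sum_hw1 (h2 : (2 : ZMod d) ≠ 0) :
    (d : ℂ)⁻¹ • ∑ a : ZMod d × ZMod d, hw1 a = pointOp1 0 := by
  have hd0 : (d : ℂ) ≠ 0 := Nat.cast_ne_zero.2 (NeZero.ne d)
  ext x y
  rw [Matrix.smul_apply, Matrix.sum_apply, Fintype.sum_prod_type, pointOp1_apply]
  have h1 : ∀ a : ZMod d, ∑ b, hw1 (a, b) x y = 𝕖 (a * ((x + y) * 2⁻¹)) := by
    intro a
    rw [Finset.sum_eq_single (x - y)]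
    · rw [hw1_apply, if_pos (by simp)]
      congr 1
      field_simp
      ring
    · intro b _ hb
      rw [hw1_apply, if_neg]
      intro h
      exact hb (by simp [h])
    · simp
  simp only [h1, sum_stdAddChar_mul]
  by_cases h : x + y = 0
  · simp [h, hd0]
  · simp [h, h2]

theorem hw1_conj_pointOp1 (a : ZMod d × ZMod d) (h2 : (2 : ZMod d) ≠ 0) :
    hw1 a * pointOp1 0 * (hw1 a)ᴴ = pointOp1 a := by
  ext x y
  rw [hw1_conjTranspose _ h2, Matrix.mul_apply, Finset.sum_eq_single (y - a.2), Matrix.mul_apply,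
    Finset.sum_eq_single (x - a.2)]
  · have e1 : hw1 a x (x - a.2) = 𝕖 (a.1 * x - a.1 * a.2 * 2⁻¹) := by
      rw [hw1_apply, if_pos (by ring)]
    have e2 : hw1 (-a) (y - a.2) y = 𝕖 (-a.1 * (y - a.2) - a.1 * a.2 * 2⁻¹) := by
      rw [hw1_apply, if_pos (by rw [Prod.snd_neg]; ring), Prod.fst_neg, Prod.snd_neg, neg_mul_neg]
    rw [e1, e2, pointOp1_apply, pointOp1_apply, Prod.fst_zero, Prod.snd_zero, zero_mul, mul_zero,
      AddChar.map_zero_eq_one]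
    by_cases h : x + y = 2 * a.2
    · rw [if_pos h, if_pos (by linear_combination h), mul_one, ← AddChar.map_add_eq_mul]
      congr 1
      field_simp
      ring
    · rw [if_neg h, if_neg (fun h' => h (by linear_combination h')), mul_zero, zero_mul]
  · intro z _ hz
    rw [hw1_apply, if_neg, zero_mul]
    intro h
    exact hz (by rw [h]; ring)
  · simp
  · intro z _ hz
    rw [hw1_apply, if_neg, mul_zero]
    intro h
    exact hz (by rw [h, Prod.snd_neg]; ring)
  · simp

/-- Distributivity turns the sum over phase space into a tensor product of one-qudit sums; this
makes all later computations sitewise. -/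
theorem pointOpZero_eq {n : ℕ} (h2 : (2 : ZMod d) ≠ 0) :
    pointOpZero d n = siteProd fun _ => pointOp1 0 := by
  simp only [← sum_hw1 h2, siteProd_smul, Finset.prod_const, Finset.card_univ, Fintype.card_fin,
    ← sum_siteProd, inv_pow]
  rfl

theorem pointOp_eq {n : ℕ} (u : PhaseSpace d n) (h2 : (2 : ZMod d) ≠ 0) :
    pointOp u = siteProd fun i => pointOp1 (u i) := by
  rw [pointOp, pointOpZero_eq h2, hw_eq_siteProd, siteProd_conjTranspose, siteProd_mul,
    siteProd_mul]
  simp only [hw1_conj_pointOp1 _ h2]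

end Weyl

/-! ### Clifford unitaries act on phase space by affine permutations -/

section Clifford

variable {d : ℕ} [Fact d.Prime]

local notation "𝕖" => (ZMod.stdAddChar : AddChar (ZMod d) ℂ)

/-- The additive character `v ↦ ω^[w, v]` of phase space. -/
noncomputable def symplChar {n : ℕ} (w : PhaseSpace d n) : AddChar (PhaseSpace d n) ℂ where
  toFun v := 𝕖 (symplForm w v)
  map_zero_eq_one' := by simp [symplForm]
  map_add_eq_mul' v v' := by rw [symplForm_add_right, AddChar.map_add_eq_mul]

theorem symplChar_apply {n : ℕ} (w v : PhaseSpace d n) :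
    symplChar w v = 𝕖 (symplForm w v) := rfl

/-- Every character of phase space comes from the symplectic form. -/
theorem symplChar_surjective {n : ℕ} :
    Function.Surjective (symplChar : PhaseSpace d n → AddChar (PhaseSpace d n) ℂ) := by
  refine ((Fintype.bijective_iff_injective_and_card _).2 ⟨fun u v h => ?_, ?_⟩).2
  · rw [← sub_eq_zero]
    refine symplForm_nondegenerate fun w => ?_
    have h1 := ZMod.injective_stdAddChar (DFunLike.congr_fun h w : 𝕖 _ = 𝕖 _)
    have h2 := symplForm_add_left (u - v) v w
    rw [sub_add_cancel] at h2
    linear_combination h1 - h2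
  -- A finite abelian group has as many complex characters as elements, so injectivity is enough.
  · exact (AddChar.card_eq).symm

theorem hw_conj_pointOp {n : ℕ} (u w : PhaseSpace d n) (h2 : (2 : ZMod d) ≠ 0) :
    hw u * pointOp w * (hw u)ᴴ = pointOp (u + w) := by
  have h : hw u * hw w = 𝕖 (2⁻¹ * symplForm u w) • hw (u + w) := hw_mul u w h2
  have h' : (hw w)ᴴ * (hw u)ᴴ = star (𝕖 (2⁻¹ * symplForm u w)) • (hw (u + w))ᴴ := by
    rw [← Matrix.conjTranspose_mul, h, Matrix.conjTranspose_smul]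
  calc hw u * pointOp w * (hw u)ᴴ
      = (hw u * hw w) * pointOpZero d n * ((hw w)ᴴ * (hw u)ᴴ) := by
        simp only [pointOp, Matrix.mul_assoc]
    _ = pointOp (u + w) := by
        rw [h, h', Matrix.smul_mul, Matrix.smul_mul, Matrix.mul_smul, smul_smul, conj_stdAddChar,
          ← AddChar.map_add_eq_mul, add_neg_cancel, AddChar.map_zero_eq_one, one_smul, pointOp]

/-- Clifford unitaries permute the phase space point operators. -/
theorem IsClifford.exists_perm {n : ℕ} {U : QOp d n} (hU : IsClifford U)
    (h2 : (2 : ZMod d) ≠ 0) :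
    ∃ π : Equiv.Perm (PhaseSpace d n), ∀ u, U * pointOp u * Uᴴ = pointOp (π u) := by
  obtain ⟨hmem, hconj⟩ := hU
  have hUU : Uᴴ * U = 1 := (Matrix.mem_unitaryGroup_iff').1 hmem
  choose φ S hS using hconj
  obtain ⟨c, hcdef⟩ : ∃ c : PhaseSpace d n → ℂ, c = fun u => Complex.exp (Complex.I * φ u) :=
    ⟨_, rfl⟩
  have hSc : ∀ u, U * hw u * Uᴴ = c u • hw (S u) := by rw [hcdef]; exact hS
  have hc0 : ∀ u, c u ≠ 0 := by rw [hcdef]; exact fun u => Complex.exp_ne_zero _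
  have hcs : ∀ u, c u * star (c u) = 1 := by
    intro u
    rw [hcdef]
    have := Complex.mul_conj (Complex.exp (Complex.I * φ u))
    rw [Complex.normSq_eq_norm_sq, mul_comm Complex.I, Complex.norm_exp_ofReal_mul_I] at this
    simpa [mul_comm Complex.I] using this
  have he0 : ∀ x, 𝕖 x ≠ 0 := fun x => norm_ne_zero_iff.1 (by
    rw [norm_stdAddChar]; exact one_ne_zero)
  have hmul : ∀ A B : QOp d n, U * A * Uᴴ * (U * B * Uᴴ) = U * (A * B) * Uᴴ := by
    intro A B
    calc U * A * Uᴴ * (U * B * Uᴴ) = U * A * (Uᴴ * U) * (B * Uᴴ) := by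
          simp only [Matrix.mul_assoc]
      _ = U * (A * B) * Uᴴ := by rw [hUU, Matrix.mul_one]; simp only [Matrix.mul_assoc]
  have hadd (u v) : S u + S v = S (u + v) ∧
      c u * c v * 𝕖 (2⁻¹ * symplForm (S u) (S v)) = 𝕖 (2⁻¹ * symplForm u v) * c (u + v) := by
    -- Conjugation by `U` is multiplicative: comparing the two expressions for the image of `hw u *
    -- hw v` gives additivity of `S` and the phase relation at once.
    refine smul_hw_inj h2 (mul_ne_zero (mul_ne_zero (hc0 u) (hc0 v)) (he0 _)) ?_
    calc (c u * c v * 𝕖 (2⁻¹ * symplForm (S u) (S v))) • hw (S u + S v)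
        = c u • hw (S u) * (c v • hw (S v)) := by
          rw [Matrix.mul_smul, Matrix.smul_mul, hw_mul _ _ h2, smul_smul, smul_smul,
            mul_comm (c u) (c v), mul_assoc]
      _ = U * (𝕖 (2⁻¹ * symplForm u v) • hw (u + v)) * Uᴴ := by
          rw [← hSc, ← hSc, hmul, hw_mul _ _ h2]
      _ = (𝕖 (2⁻¹ * symplForm u v) * c (u + v)) • hw (S (u + v)) := by
          rw [Matrix.mul_smul, Matrix.smul_mul, hSc, smul_smul]
  have hsympl (u v) : symplForm (S u) (S v) = symplForm u v := by
    have h1 := (hadd u v).2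
    have h3 := (hadd v u).2
    rw [add_comm v u, symplForm_swap u v, symplForm_swap (S u) (S v), mul_comm (c v)] at h3
    -- Playing the phase relation for `(u, v)` against that for `(v, u)` eliminates `c`, since the
    -- symplectic form is antisymmetric and the rest is symmetric.
    have h4 : 𝕖 (2⁻¹ * symplForm (S u) (S v)) * 𝕖 (2⁻¹ * -symplForm u v)
        = 𝕖 (2⁻¹ * symplForm u v) * 𝕖 (2⁻¹ * -symplForm (S u) (S v)) := by
      refine mul_left_cancel₀ (mul_ne_zero (mul_ne_zero (hc0 u) (hc0 v)) (hc0 (u + v))) ?_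
      linear_combination (𝕖 (2⁻¹ * -symplForm u v) * c (u + v)) * h1
        - (𝕖 (2⁻¹ * symplForm u v) * c (u + v)) * h3
    rw [← AddChar.map_add_eq_mul, ← AddChar.map_add_eq_mul] at h4
    have h5 := ZMod.injective_stdAddChar h4
    field_simp at h5
    refine mul_left_cancel₀ h2 ?_
    linear_combination h5
  have hchar (u v) : c (u + v) = c u * c v := by
    have h1 := (hadd u v).2
    rw [hsympl, mul_comm] at h1
    exact (mul_left_cancel₀ (he0 _) h1).symm
  have hSinj : Function.Injective S := by
    intro u v h
    rw [← sub_eq_zero]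
    refine symplForm_nondegenerate fun w => ?_
    have h1 := hsympl u w
    rw [h, hsympl v w] at h1
    have h3 := symplForm_add_left (u - v) v w
    rw [sub_add_cancel] at h3
    linear_combination -h1 - h3
  obtain ⟨σ, hσ⟩ : ∃ σ : Equiv.Perm (PhaseSpace d n), ∀ u, σ u = S u :=
    ⟨Equiv.ofBijective S (Finite.injective_iff_bijective.1 hSinj), fun _ => rfl⟩
  -- As `S` is an additive bijection and `c` is multiplicative, `c ∘ S⁻¹` is a character, hence of
  -- the form `ω^[w, ·]`.
  let χ : AddChar (PhaseSpace d n) ℂ :=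
    { toFun := fun v => c (σ.symm v)
      map_zero_eq_one' := by
        have h0 : σ.symm 0 = 0 := by
          rw [Equiv.symm_apply_eq, hσ]
          have := (hadd 0 0).1
          rw [add_zero] at this
          exact (add_eq_left.1 this).symm
        have h1 := hchar 0 0
        rw [add_zero] at h1
        rw [h0]
        exact (mul_eq_left₀ (hc0 0)).1 h1.symm
      map_add_eq_mul' := by
        intro v v'
        rw [← hchar]
        congr 1
        rw [Equiv.symm_apply_eq, hσ, ← (hadd _ _).1, ← hσ, ← hσ, Equiv.apply_symm_apply,
          Equiv.apply_symm_apply] }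
  obtain ⟨w, hw'⟩ := symplChar_surjective χ
  have hcw (u) : c u = 𝕖 (symplForm w (S u)) := by
    have := DFunLike.congr_fun hw' (S u)
    rw [symplChar_apply] at this
    rw [this]
    change c u = c (σ.symm (S u))
    rw [← hσ, Equiv.symm_apply_apply]
  -- The phases `c u = ω^[w, S u]` are those produced by conjugating with `hw w`, so `U` moves `A_0`
  -- to `A_w`; the permutation sought is therefore `u ↦ S u + w`.
  have hzero : U * pointOpZero d n * Uᴴ = pointOp w := by
    rw [pointOp, pointOpZero, Matrix.mul_smul, Matrix.smul_mul, Matrix.mul_smul, Matrix.smul_mul,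
      Matrix.mul_sum, Matrix.sum_mul, Matrix.mul_sum, Matrix.sum_mul, ← Equiv.sum_comp σ
        fun v => hw w * hw v * (hw w)ᴴ]
    congr 1
    refine Finset.sum_congr rfl fun u _ => ?_
    rw [hSc, hw_conj_hw _ _ h2, hσ, hcw]
  refine ⟨σ.trans (Equiv.addRight w), fun u => ?_⟩
  have hstar : U * (hw u)ᴴ * Uᴴ = star (c u) • (hw (S u))ᴴ := by
    rw [← Matrix.conjTranspose_smul, ← hSc]
    simp only [Matrix.conjTranspose_mul, Matrix.conjTranspose_conjTranspose, Matrix.mul_assoc]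
  rw [pointOp, ← hmul, ← hmul, hSc, hzero, hstar, Matrix.smul_mul, Matrix.smul_mul,
    Matrix.mul_smul, smul_smul, hcs, one_smul, hw_conj_pointOp _ _ h2]
  simp [hσ]

end Clifford

/-! ### The Wigner norm and its behaviour under elementary operations -/

section Wigner

set_option linter.unusedSectionVars false

variable {d : ℕ} [Fact d.Prime]

local notation "𝕖" => (ZMod.stdAddChar : AddChar (ZMod d) ℂ)

/-- The Wigner function of an arbitrary operator, with complex values. -/
noncomputable def opWigner {n : ℕ} (ρ : QOp d n) (u : PhaseSpace d n) : ℂ :=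
  ((d : ℂ) ^ n)⁻¹ * (pointOp u * ρ).trace

/-- The `ℓ¹`-norm of the Wigner function of an operator. -/
noncomputable def wignerNorm {n : ℕ} (ρ : QOp d n) : ℝ := ∑ u, ‖opWigner ρ u‖

theorem dim_cast_ne_zero : (d : ℂ) ≠ 0 := Nat.cast_ne_zero.2 (NeZero.ne d)

theorem opWigner_sum {n : ℕ} {ι : Type*} (s : Finset ι) (ρ : ι → QOp d n) (u : PhaseSpace d n) :
    opWigner (∑ i ∈ s, ρ i) u = ∑ i ∈ s, opWigner (ρ i) u := by
  simp only [opWigner, Matrix.trace_sum, Finset.mul_sum]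

theorem opWigner_smul {n : ℕ} (c : ℂ) (ρ : QOp d n) (u : PhaseSpace d n) :
    opWigner (c • ρ) u = c * opWigner ρ u := by
  simp only [opWigner, Matrix.mul_smul, Matrix.trace_smul, smul_eq_mul, mul_left_comm]

theorem opWigner_zero {n : ℕ} (u : PhaseSpace d n) : opWigner (0 : QOp d n) u = 0 := by
  simp [opWigner]

theorem wignerNorm_nonneg {n : ℕ} (ρ : QOp d n) : 0 ≤ wignerNorm ρ :=
  Finset.sum_nonneg fun _ _ => norm_nonneg _

theorem wignerNorm_zero {n : ℕ} : wignerNorm (0 : QOp d n) = 0 := by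
  simp [wignerNorm, opWigner_zero]

theorem wignerNorm_sum_le {n : ℕ} {ι : Type*} (s : Finset ι) (ρ : ι → QOp d n) :
    wignerNorm (∑ i ∈ s, ρ i) ≤ ∑ i ∈ s, wignerNorm (ρ i) := by
  simp only [wignerNorm, opWigner_sum]
  rw [Finset.sum_comm]
  exact Finset.sum_le_sum fun u _ => norm_sum_le _ _

theorem wignerNorm_add_le {n : ℕ} (ρ σ : QOp d n) :
    wignerNorm (ρ + σ) ≤ wignerNorm ρ + wignerNorm σ := by
  simpa using wignerNorm_sum_le Finset.univ ![ρ, σ]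

theorem wignerNorm_smul {n : ℕ} (c : ℂ) (ρ : QOp d n) :
    wignerNorm (c • ρ) = ‖c‖ * wignerNorm ρ := by
  simp only [wignerNorm, opWigner_smul, norm_mul, Finset.mul_sum]

theorem pointOp1_conjTranspose (a : ZMod d × ZMod d) : (pointOp1 a)ᴴ = pointOp1 a := by
  ext x y
  rw [Matrix.conjTranspose_apply, pointOp1_apply, pointOp1_apply, add_comm y x]
  split_ifs
  · rw [conj_stdAddChar]
    congr 1
    ring
  · exact star_zero _

theorem pointOp_conjTranspose {n : ℕ} (u : PhaseSpace d n) (h2 : (2 : ZMod d) ≠ 0) :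
    (pointOp u)ᴴ = pointOp u := by
  simp only [pointOp_eq _ h2, siteProd_conjTranspose, pointOp1_conjTranspose]

theorem opWigner_eq_wigner {n : ℕ} (ρ : QState d n) (u : PhaseSpace d n)
    (h2 : (2 : ZMod d) ≠ 0) : opWigner ρ.1 u = (wigner ρ u : ℂ) := by
  have h : star (pointOp u * ρ.1).trace = (pointOp u * ρ.1).trace := by
    rw [← Matrix.trace_conjTranspose, Matrix.conjTranspose_mul, pointOp_conjTranspose _ h2,
      ρ.2.1.1.eq, Matrix.trace_mul_comm]
  rw [opWigner, wigner]
  push_cast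
  rw [Complex.conj_eq_iff_re.1 h]

theorem wignerNorm_eq {n : ℕ} (ρ : QState d n) (h2 : (2 : ZMod d) ≠ 0) :
    wignerNorm ρ.1 = ∑ u, |wigner ρ u| := by
  simp only [wignerNorm, opWigner_eq_wigner _ _ h2, Complex.norm_real, Real.norm_eq_abs]

theorem mana_eq_log_wignerNorm {n : ℕ} (ρ : QState d n) (h2 : (2 : ZMod d) ≠ 0) :
    mana n ρ = Real.log (wignerNorm ρ.1) := by
  rw [mana, wignerNorm_eq ρ h2]

/-- The average over a line with fixed second coordinate is the projector `|b⟩⟨b|`: the character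
sum kills the off-diagonal entries. This links phase space to computational basis measurements. -/
theorem sum_pointOp1_fst (b x y : ZMod d) (h2 : (2 : ZMod d) ≠ 0) :
    (d : ℂ)⁻¹ * ∑ a, pointOp1 (a, b) x y = if x = b ∧ y = b then 1 else 0 := by
  simp only [pointOp1_apply]
  by_cases h : x + y = 2 * b
  · simp only [h, if_true, sum_stdAddChar_mul]
    by_cases hxy : x = y
    · subst hxy
      have hx : x = b := mul_left_cancel₀ h2 (by rw [← h]; ring)
      simp [hx]
    · rw [if_neg (sub_ne_zero.2 hxy), mul_zero, if_neg]
      rintro ⟨rfl, rfl⟩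
      exact hxy rfl
  · simp only [h, if_false, Finset.sum_const_zero, mul_zero]
    rw [if_neg]
    rintro ⟨rfl, rfl⟩
    exact h (by ring)

theorem sum_pointOp1_apply (x y : ZMod d) (h2 : (2 : ZMod d) ≠ 0) :
    ∑ a, pointOp1 a x y = if x = y then (d : ℂ) else 0 := by
  have h (b : ZMod d) : ∑ a, pointOp1 (a, b) x y = d * if x = b ∧ y = b then 1 else 0 := by
    rw [← sum_pointOp1_fst b x y h2, mul_inv_cancel_left₀ dim_cast_ne_zero]
  rw [Fintype.sum_prod_type_right]
  simp only [h]
  rw [← Finset.mul_sum]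
  by_cases hxy : x = y
  · subst hxy
    simp
  · rw [if_neg hxy, Finset.sum_eq_zero, mul_zero]
    intro b _
    rw [if_neg]
    rintro ⟨rfl, rfl⟩
    exact hxy rfl

theorem sum_pointOp {n : ℕ} (h2 : (2 : ZMod d) ≠ 0) :
    ∑ u : PhaseSpace d n, pointOp u = ((d : ℂ) ^ n) • 1 := by
  have h : ∑ a : ZMod d × ZMod d, pointOp1 a = (d : ℂ) • 1 := by
    ext x y
    rw [Matrix.sum_apply, sum_pointOp1_apply _ _ h2]
    simp [Matrix.one_apply]
  simp only [pointOp_eq _ h2]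
  rw [sum_siteProd, h, siteProd_smul, siteProd_one]
  simp

theorem sum_opWigner {n : ℕ} (ρ : QOp d n) (h2 : (2 : ZMod d) ≠ 0) :
    ∑ u, opWigner ρ u = ρ.trace := by
  simp only [opWigner]
  rw [← Finset.mul_sum, ← Matrix.trace_sum, ← Matrix.sum_mul, sum_pointOp h2, Matrix.smul_mul,
    Matrix.trace_smul, Matrix.one_mul, smul_eq_mul,
    inv_mul_cancel_left₀ (pow_ne_zero _ dim_cast_ne_zero)]

theorem sum_wigner {n : ℕ} (ρ : QState d n) (h2 : (2 : ZMod d) ≠ 0) : ∑ u, wigner ρ u = 1 := by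
  have h := sum_opWigner ρ.1 h2
  simp only [opWigner_eq_wigner _ _ h2, ρ.2.2] at h
  exact_mod_cast h

theorem one_le_wignerNorm {n : ℕ} (ρ : QState d n) (h2 : (2 : ZMod d) ≠ 0) :
    1 ≤ wignerNorm ρ.1 := by
  rw [wignerNorm_eq ρ h2, ← sum_wigner ρ h2]
  exact Finset.sum_le_sum fun u _ => le_abs_self _

/-- Pointwise `|W|` is `W` plus twice its negative part, and `W` sums to 1. -/
theorem sum_abs_wigner {n : ℕ} (ρ : QState d n) (h2 : (2 : ZMod d) ≠ 0) :
    ∑ u, |wigner ρ u| = 2 * sumNegativity ρ + 1 := by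
  rw [sumNegativity, Finset.mul_sum, ← sum_wigner ρ h2, ← Finset.sum_add_distrib]
  refine Finset.sum_congr rfl fun u _ => ?_
  split_ifs with h
  · rw [abs_of_neg h]
    ring
  · rw [abs_of_nonneg (not_lt.1 h)]
    ring

theorem wignerNorm_clifford {n : ℕ} {U : QOp d n} (hU : IsClifford U) (ρ : QOp d n)
    (h2 : (2 : ZMod d) ≠ 0) : wignerNorm (U * ρ * Uᴴ) = wignerNorm ρ := by
  obtain ⟨π, hπ⟩ := hU.exists_perm h2
  have hUU : Uᴴ * U = 1 := (Matrix.mem_unitaryGroup_iff').1 hU.1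
  rw [wignerNorm, ← Equiv.sum_comp π]
  refine Finset.sum_congr rfl fun u _ => ?_
  have h : (pointOp (π u) * (U * ρ * Uᴴ)).trace = (pointOp u * ρ).trace := by
    calc (pointOp (π u) * (U * ρ * Uᴴ)).trace
        = (U * pointOp u * (Uᴴ * U) * ρ * Uᴴ).trace := by rw [← hπ]; simp only [Matrix.mul_assoc]
      _ = (Uᴴ * (U * (pointOp u * ρ))).trace := by
        rw [Matrix.trace_mul_comm, hUU, Matrix.mul_one]; simp only [Matrix.mul_assoc]
      _ = (pointOp u * ρ).trace := by rw [← Matrix.mul_assoc, hUU, Matrix.one_mul]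
  rw [opWigner, h, opWigner]

theorem tensorOp_mul {n m : ℕ} (A C : QOp d n) (B D : QOp d m) :
    tensorOp A B * tensorOp C D = tensorOp (A * C) (B * D) := by
  simp only [tensorOp, Matrix.mul_kronecker_mul, Matrix.reindex_apply, Matrix.submatrix_mul_equiv]

theorem trace_tensorOp {n m : ℕ} (A : QOp d n) (B : QOp d m) :
    (tensorOp A B).trace = A.trace * B.trace := by
  rw [← Matrix.trace_kronecker]
  exact Equiv.sum_comp (Fin.appendEquiv n m).symm fun p => (A ⊗ₖ B) p p

theorem pointOp_append {n m : ℕ} (u : PhaseSpace d n) (v : PhaseSpace d m)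
    (h2 : (2 : ZMod d) ≠ 0) :
    pointOp (Fin.append u v) = tensorOp (pointOp u) (pointOp v) := by
  ext x y
  simp only [pointOp_eq _ h2, siteProd, Matrix.of_apply, Fin.prod_univ_add, Fin.append_left,
    Fin.append_right]
  rfl

theorem opWigner_tensorOp {n m : ℕ} (ρ : QOp d n) (σ : QOp d m) (u : PhaseSpace d n)
    (v : PhaseSpace d m) (h2 : (2 : ZMod d) ≠ 0) :
    opWigner (tensorOp ρ σ) (Fin.append u v) = opWigner ρ u * opWigner σ v := by
  rw [opWigner, pointOp_append _ _ h2, tensorOp_mul, trace_tensorOp, pow_add, mul_inv, opWigner,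
    opWigner]
  ring

theorem wignerNorm_tensorOp {n m : ℕ} (ρ : QOp d n) (σ : QOp d m) (h2 : (2 : ZMod d) ≠ 0) :
    wignerNorm (tensorOp ρ σ) = wignerNorm ρ * wignerNorm σ := by
  rw [wignerNorm, ← Equiv.sum_comp (Fin.appendEquiv n m), Fintype.sum_prod_type, wignerNorm,
    wignerNorm, Finset.sum_mul_sum]
  refine Finset.sum_congr rfl fun u _ => Finset.sum_congr rfl fun v _ => ?_
  rw [← norm_mul, ← opWigner_tensorOp _ _ _ _ h2]
  rfl

/-- The Wigner function of `|0⟩⟨0|` has modulus `d^(-n)` on the `d^n` points whose second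
coordinates all vanish, and is zero elsewhere. -/
theorem wignerNorm_single_zero {n : ℕ} (h2 : (2 : ZMod d) ≠ 0) :
    wignerNorm (Matrix.single 0 0 1 : QOp d n) = 1 := by
  have h1 (b : ZMod d) : ∑ a, ‖pointOp1 (a, b) 0 0‖ = if b = 0 then (d : ℝ) else 0 := by
    simp only [pointOp1_apply]
    by_cases h : b = 0 <;> simp [h, h2, eq_comm (a := (0 : ZMod d)), ZMod.card]
  have h3 (u : PhaseSpace d n) : ‖opWigner (Matrix.single 0 0 1 : QOp d n) u‖
      = ((d : ℝ) ^ n)⁻¹ * ∏ i, ‖pointOp1 (u i) 0 0‖ := by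
    rw [opWigner, Matrix.trace_mul_single, pointOp_eq _ h2, siteProd, norm_mul, norm_inv, norm_pow]
    simp [norm_prod]
  have h4 : ∑ a : ZMod d × ZMod d, ‖pointOp1 a 0 0‖ = d := by
    rw [Fintype.sum_prod_type_right]
    simp [h1]
  simp only [wignerNorm, h3]
  rw [← Finset.mul_sum]
  have h5 := Fintype.prod_sum fun (_ : Fin n) (a : ZMod d × ZMod d) => ‖pointOp1 a 0 0‖
  rw [← h5, h4]
  have : (d : ℝ) ≠ 0 := Nat.cast_ne_zero.2 (NeZero.ne d)
  simp [this]

/-- The unit ball of `wignerNorm` is convex and contains every Clifford image of `|0⟩⟨0|`. -/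
theorem wignerNorm_le_one_of_mem_STAB {n : ℕ} {S : QOp d n} (hS : S ∈ STAB d n)
    (h2 : (2 : ZMod d) ≠ 0) : wignerNorm S ≤ 1 := by
  have hc : Convex ℝ {A : QOp d n | wignerNorm A ≤ 1} := by
    intro A hA B hB a b ha hb hab
    have e (c : ℝ) (hc : 0 ≤ c) (C : QOp d n) : wignerNorm (c • C) = c * wignerNorm C := by
      rw [← Complex.coe_smul, wignerNorm_smul, Complex.norm_real, Real.norm_of_nonneg hc]
    calc wignerNorm (a • A + b • B) ≤ a * wignerNorm A + b * wignerNorm B := by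
          rw [← e a ha, ← e b hb]; exact wignerNorm_add_le _ _
      _ ≤ a * 1 + b * 1 := by gcongr <;> assumption
      _ = 1 := by rw [mul_one, mul_one, hab]
  refine convexHull_min ?_ hc hS
  rintro _ ⟨U, hU, rfl⟩
  exact ((wignerNorm_clifford hU _ h2).trans (wignerNorm_single_zero h2)).le

theorem trace_of_mem_STAB {n : ℕ} {S : QOp d n} (hS : S ∈ STAB d n) : S.trace = 1 := by
  have hc : Convex ℝ {A : QOp d n | A.trace = 1} := by
    intro A hA B hB a b _ _ hab
    rw [Set.mem_ofPred_eq] at hA hB ⊢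
    rw [Matrix.trace_add, Matrix.trace_smul, Matrix.trace_smul, hA, hB, ← add_smul, hab, one_smul]
  refine convexHull_min ?_ hc hS
  rintro _ ⟨U, hU, rfl⟩
  have hUU : Uᴴ * U = 1 := (Matrix.mem_unitaryGroup_iff').1 hU.1
  rw [Set.mem_ofPred_eq, Matrix.mul_assoc, Matrix.trace_mul_comm, Matrix.mul_assoc, hUU,
    Matrix.mul_one, Matrix.trace_single_eq_same]

theorem sum_snoc {α M : Type*} [Fintype α] [AddCommMonoid M] {n : ℕ} (f : (Fin (n + 1) → α) → M) :
    ∑ x, f x = ∑ x : Fin n → α, ∑ i, f (Fin.snoc (α := fun _ => α) x i) := by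
  rw [← Equiv.sum_comp (Fin.snocEquiv fun _ => α), Fintype.sum_prod_type_right]
  rfl

theorem pointOp_snoc_apply {n : ℕ} (u : PhaseSpace d n) (a : ZMod d × ZMod d)
    (x y : Fin (n + 1) → ZMod d) (h2 : (2 : ZMod d) ≠ 0) :
    pointOp (Fin.snoc (α := fun _ => ZMod d × ZMod d) u a : PhaseSpace d (n + 1)) x y
      = pointOp u (Fin.init x) (Fin.init y) * pointOp1 a (x (Fin.last n)) (y (Fin.last n)) := by
  simp only [pointOp_eq _ h2, siteProd, Matrix.of_apply, Fin.prod_univ_castSucc,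
    Fin.snoc_castSucc, Fin.snoc_last]
  rfl

/-- Partial trace is marginalization, because the one-qudit point operators sum to `d` times the
identity; that `d` absorbs the change of normalization from `n + 1` to `n` qudits. -/
theorem opWigner_traceLast {n : ℕ} (ρ : QOp d (n + 1)) (u : PhaseSpace d n)
    (h2 : (2 : ZMod d) ≠ 0) :
    opWigner (traceLast ρ) u
      = ∑ a, opWigner ρ (Fin.snoc (α := fun _ => ZMod d × ZMod d) u a) := by
  have h (x y : Fin (n + 1) → ZMod d) :
      (∑ a, pointOp (Fin.snoc (α := fun _ => ZMod d × ZMod d) u a : PhaseSpace d (n + 1))) x y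
        = pointOp u (Fin.init x) (Fin.init y)
          * if x (Fin.last n) = y (Fin.last n) then (d : ℂ) else 0 := by
    rw [Matrix.sum_apply, ← sum_pointOp1_apply _ _ h2, Finset.mul_sum]
    exact Finset.sum_congr rfl fun a _ => pointOp_snoc_apply u a x y h2
  simp only [opWigner]
  rw [← Finset.mul_sum, ← Matrix.trace_sum, ← Matrix.sum_mul, pow_succ, mul_inv, mul_assoc]
  congr 1
  rw [eq_inv_mul_iff_mul_eq₀ dim_cast_ne_zero]
  simp only [Matrix.trace, Matrix.diag_apply, Matrix.mul_apply, h, sum_snoc, Fin.init_snoc,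
    Fin.snoc_last, traceLast, Matrix.of_apply, mul_ite, mul_zero, ite_mul, zero_mul,
    Finset.sum_ite_eq, Finset.mem_univ, if_true]
  simp only [Finset.mul_sum]
  refine Finset.sum_congr rfl fun x _ => ?_
  rw [Finset.sum_comm]
  exact Finset.sum_congr rfl fun i _ => Finset.sum_congr rfl fun y _ => by ring

theorem wignerNorm_traceLast_le {n : ℕ} (ρ : QOp d (n + 1)) (h2 : (2 : ZMod d) ≠ 0) :
    wignerNorm (traceLast ρ) ≤ wignerNorm ρ := by
  rw [wignerNorm, wignerNorm, sum_snoc]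
  refine Finset.sum_le_sum fun u _ => ?_
  rw [opWigner_traceLast _ _ h2]
  exact norm_sum_le _ _

/-- On the last qudit only the diagonal entry at `i` survives, equal to 1 or 0 according to `a.2`.
The resulting `|i⟩⟨i|` is then expanded again as an average of point operators by
`sum_pointOp1_fst`. -/
theorem lastProj_conj_pointOp {n : ℕ} (i : ZMod d) (u : PhaseSpace d n) (a : ZMod d × ZMod d)
    (h2 : (2 : ZMod d) ≠ 0) :
    lastProj i * pointOp (Fin.snoc (α := fun _ => ZMod d × ZMod d) u a : PhaseSpace d (n + 1))
      * lastProj i = if a.2 = i then (d : ℂ)⁻¹ • ∑ a', pointOp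
        (Fin.snoc (α := fun _ => ZMod d × ZMod d) u (a', i) : PhaseSpace d (n + 1)) else 0 := by
  ext x y
  rw [lastProj, Matrix.mul_diagonal, Matrix.diagonal_mul, pointOp_snoc_apply _ _ _ _ h2]
  have hr : ((d : ℂ)⁻¹ • ∑ a', pointOp
      (Fin.snoc (α := fun _ => ZMod d × ZMod d) u (a', i) : PhaseSpace d (n + 1))) x y
      = pointOp u (Fin.init x) (Fin.init y)
        * if x (Fin.last n) = i ∧ y (Fin.last n) = i then 1 else 0 := by
    rw [Matrix.smul_apply, Matrix.sum_apply, ← sum_pointOp1_fst _ _ _ h2, smul_eq_mul,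
      Finset.sum_congr rfl fun a' _ => pointOp_snoc_apply u (a', i) x y h2, ← Finset.mul_sum]
    ring
  have hl : (if (a.2 = i) then ((d : ℂ)⁻¹ • ∑ a', pointOp
      (Fin.snoc (α := fun _ => ZMod d × ZMod d) u (a', i) : PhaseSpace d (n + 1))) else 0) x y
      = if a.2 = i then pointOp u (Fin.init x) (Fin.init y)
        * (if x (Fin.last n) = i ∧ y (Fin.last n) = i then 1 else 0) else 0 := by
    by_cases h : a.2 = i
    · rw [if_pos h, if_pos h, hr]
    · rw [if_neg h, if_neg h, Matrix.zero_apply]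
  rw [hl, pointOp1_apply]
  by_cases hx : x (Fin.last n) = i
  · by_cases hy : y (Fin.last n) = i
    · have h3 : i + i = 2 * a.2 ↔ a.2 = i := by
        rw [← two_mul, mul_right_inj' h2, eq_comm]
      simp [hx, hy, h3]
    · simp [hy]
  · simp [hx]

theorem opWigner_measure {n : ℕ} (ρ : QOp d (n + 1)) (i : ZMod d) (u : PhaseSpace d n)
    (a : ZMod d × ZMod d) (h2 : (2 : ZMod d) ≠ 0) :
    opWigner (lastProj i * ρ * lastProj i) (Fin.snoc (α := fun _ => ZMod d × ZMod d) u a)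
      = if a.2 = i then (d : ℂ)⁻¹ * ∑ a', opWigner ρ
        (Fin.snoc (α := fun _ => ZMod d × ZMod d) u (a', i)) else 0 := by
  have h : (pointOp (Fin.snoc (α := fun _ => ZMod d × ZMod d) u a : PhaseSpace d (n + 1))
      * (lastProj i * ρ * lastProj i)).trace = ((lastProj i * pointOp
        (Fin.snoc (α := fun _ => ZMod d × ZMod d) u a : PhaseSpace d (n + 1)) * lastProj i)
        * ρ).trace := by
    rw [← Matrix.mul_assoc, Matrix.trace_mul_comm]
    simp only [Matrix.mul_assoc]
  rw [opWigner, h, lastProj_conj_pointOp _ _ _ h2]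
  split_ifs
  · simp only [opWigner, Matrix.smul_mul, Matrix.trace_smul, Matrix.sum_mul, Matrix.trace_sum,
      smul_eq_mul, Finset.mul_sum]
    exact Finset.sum_congr rfl fun _ _ => by ring
  · simp

/-- Outcome `i` is supported on `a.2 = i`, where it takes the line average of the original function
at each of `d` points. The factor `d` cancels, the triangle inequality bounds each line, and the
lines for distinct `i` partition the points. -/
theorem sum_wignerNorm_measure_le {n : ℕ} (ρ : QOp d (n + 1)) (h2 : (2 : ZMod d) ≠ 0) :
    ∑ i, wignerNorm (lastProj i * ρ * lastProj i) ≤ wignerNorm ρ := by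
  have hd0 : (d : ℝ) ≠ 0 := Nat.cast_ne_zero.2 (NeZero.ne d)
  simp only [wignerNorm, sum_snoc, opWigner_measure _ _ _ _ h2]
  rw [Finset.sum_comm]
  refine Finset.sum_le_sum fun u _ => ?_
  rw [Fintype.sum_prod_type_right]
  refine Finset.sum_le_sum fun i _ => ?_
  rw [Fintype.sum_prod_type_right, Finset.sum_eq_single i]
  · simp only [if_true, Finset.sum_const, Finset.card_univ, ZMod.card, nsmul_eq_mul, norm_mul,
      norm_inv, Complex.norm_natCast]
    rw [mul_inv_cancel_left₀ hd0]
    exact norm_sum_le _ _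
  · intro j _ hj
    simp [hj]
  · simp

theorem trace_traceLast {n : ℕ} (ρ : QOp d (n + 1)) : (traceLast ρ).trace = ρ.trace := by
  simp only [Matrix.trace, Matrix.diag_apply, sum_snoc, traceLast, Matrix.of_apply]

theorem sum_trace_measure {n : ℕ} (ρ : QOp d (n + 1)) :
    ∑ i, (lastProj i * ρ * lastProj i).trace = ρ.trace := by
  simp only [Matrix.trace, Matrix.diag_apply, lastProj, Matrix.mul_diagonal, Matrix.diagonal_mul]
  rw [Finset.sum_comm]
  simp

end Wigner

/-! ### From elementary operations to protocols, and logarithms -/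

section Monotone

variable {d : ℕ} [Fact d.Prime] {r : ℕ} {m : Fin r → ℕ}

namespace StabProtocol

/-- Arbitrary operators are allowed because the induction passes through unnormalized
post-measurement operators. Merging runs that announce the same `k` costs only a triangle
inequality. -/
theorem sum_wignerNorm_branch_le {n : ℕ} (Λ : StabProtocol d m n) (ρ : QOp d n)
    (h2 : (2 : ZMod d) ≠ 0) : ∑ k, wignerNorm (Λ.branch ρ k) ≤ wignerNorm ρ := by
  induction Λ with
  | out l =>
    rw [Finset.sum_eq_single l]
    · simp [branch]
    · intro k _ hk
      simp [branch, hk.symm, wignerNorm_zero]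
    · simp
  | clifford U hU next ih => exact (ih _).trans (wignerNorm_clifford hU ρ h2).le
  | append S hS next ih =>
    refine (ih _).trans ?_
    rw [wignerNorm_tensorOp _ _ h2]
    exact mul_le_of_le_one_right (wignerNorm_nonneg _) (wignerNorm_le_one_of_mem_STAB hS h2)
  | measure next ih =>
    calc _ ≤ ∑ k, ∑ i, wignerNorm ((next i).branch (lastProj i * ρ * lastProj i) k) :=
          Finset.sum_le_sum fun k _ => wignerNorm_sum_le _ _
      _ ≤ ∑ i, wignerNorm (lastProj i * ρ * lastProj i) := by
          rw [Finset.sum_comm]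
          exact Finset.sum_le_sum fun i _ => ih i _
      _ ≤ _ := sum_wignerNorm_measure_le ρ h2
  | discard next ih => exact (ih _).trans (wignerNorm_traceLast_le ρ h2)
  | random w w_nonneg w_sum next ih =>
    calc _ ≤ ∑ k, ∑ j, wignerNorm ((w j : ℂ) • (next j).branch ρ k) :=
          Finset.sum_le_sum fun k _ => wignerNorm_sum_le _ _
      _ = ∑ j, w j * ∑ k, wignerNorm ((next j).branch ρ k) := by
          rw [Finset.sum_comm]
          simp only [wignerNorm_smul, Complex.norm_real, Real.norm_of_nonneg (w_nonneg _),
            Finset.mul_sum]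
      _ ≤ ∑ j, w j * wignerNorm ρ :=
          Finset.sum_le_sum fun j _ => mul_le_mul_of_nonneg_left (ih j _) (w_nonneg j)
      _ = wignerNorm ρ := by rw [← Finset.sum_mul, w_sum, one_mul]

theorem sum_trace_branch {n : ℕ} (Λ : StabProtocol d m n) (ρ : QOp d n) :
    ∑ k, (Λ.branch ρ k).trace = ρ.trace := by
  induction Λ with
  | out l =>
    rw [Finset.sum_eq_single l]
    · simp [branch]
    · intro k _ hk
      simp [branch, hk.symm]
    · simp
  | clifford U hU next ih =>
    refine (ih _).trans ?_
    have hUU : Uᴴ * U = 1 := (Matrix.mem_unitaryGroup_iff').1 hU.1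
    rw [Matrix.trace_mul_comm, ← Matrix.mul_assoc, hUU, Matrix.one_mul]
  | append S hS next ih =>
    refine (ih _).trans ?_
    rw [trace_tensorOp, trace_of_mem_STAB hS, mul_one]
  | measure next ih =>
    simp only [branch, Matrix.trace_sum]
    rw [Finset.sum_comm, Finset.sum_congr rfl fun i _ => ih i _, sum_trace_measure]
  | discard next ih => exact (ih _).trans (trace_traceLast ρ)
  | random w w_nonneg w_sum next ih =>
    simp only [branch, Matrix.trace_sum, Matrix.trace_smul]
    rw [Finset.sum_comm]
    simp only [← Finset.smul_sum, ih]
    rw [← Finset.sum_smul, ← Complex.ofReal_sum, w_sum, Complex.ofReal_one, one_smul]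

theorem prob_nonneg {n : ℕ} (Λ : StabProtocol d m n) (ρ : QState d n) (k : Fin r) :
    0 ≤ Λ.prob ρ k :=
  (Complex.le_def.1 (Λ.posSemidef_branch ρ.1 ρ.2.1 k).trace_nonneg).1

theorem sum_prob {n : ℕ} (Λ : StabProtocol d m n) (ρ : QState d n) : ∑ k, Λ.prob ρ k = 1 := by
  have h := congrArg Complex.re (Λ.sum_trace_branch ρ.1)
  rw [ρ.2.2, Complex.re_sum] at h
  exact h

end StabProtocol

theorem isMagicMonotone_mana (h2 : (2 : ZMod d) ≠ 0) : IsMagicMonotone (d := d) mana := by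
  intro n r m Λ ρ
  have hN : 0 < wignerNorm ρ.1 := one_pos.trans_le (one_le_wignerNorm ρ h2)
  -- The right-hand side is linear in the branch norm and the probability, so it can be summed over
  -- `k`; at probability zero it reduces to a nonnegative quotient.
  have hterm (k : Fin r) :
      (if hk : 0 < Λ.prob ρ k then Λ.prob ρ k * mana (m k) (Λ.outState ρ k hk) else 0)
        ≤ wignerNorm (Λ.branch ρ.1 k) / wignerNorm ρ.1 - Λ.prob ρ k
          + Λ.prob ρ k * Real.log (wignerNorm ρ.1) := by
    split_ifs with hk
    · have h1 : 0 < wignerNorm (Λ.outState ρ k hk).1 :=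
        one_pos.trans_le (one_le_wignerNorm _ h2)
      have h3 : wignerNorm (Λ.outState ρ k hk).1
          = (Λ.prob ρ k)⁻¹ * wignerNorm (Λ.branch ρ.1 k) := by
        rw [StabProtocol.outState, wignerNorm_smul, Complex.norm_real,
          Real.norm_of_nonneg (inv_nonneg.2 hk.le)]
      have h4 := Real.log_le_sub_one_of_pos (div_pos h1 hN)
      rw [Real.log_div h1.ne' hN.ne'] at h4
      have h5 := mul_le_mul_of_nonneg_left h4 hk.le
      -- Multiplying by `p_k` undoes the normalization of `σ_k`, leaving the norm of the branch
      -- itself.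
      have h6 : Λ.prob ρ k * (wignerNorm (Λ.outState ρ k hk).1 / wignerNorm ρ.1 - 1)
          = wignerNorm (Λ.branch ρ.1 k) / wignerNorm ρ.1 - Λ.prob ρ k := by
        rw [h3]
        field_simp
      rw [mana_eq_log_wignerNorm _ h2]
      linarith
    · have h1 : Λ.prob ρ k = 0 := le_antisymm (not_lt.1 hk) (Λ.prob_nonneg ρ k)
      rw [h1, zero_mul, sub_zero, add_zero]
      exact div_nonneg (wignerNorm_nonneg _) hN.le
  calc Λ.average mana ρ
      ≤ ∑ k, (wignerNorm (Λ.branch ρ.1 k) / wignerNorm ρ.1 - Λ.prob ρ k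
          + Λ.prob ρ k * Real.log (wignerNorm ρ.1)) := Finset.sum_le_sum fun k _ => hterm k
    _ = (∑ k, wignerNorm (Λ.branch ρ.1 k)) / wignerNorm ρ.1 - 1 + mana n ρ := by
        rw [Finset.sum_add_distrib, Finset.sum_sub_distrib, ← Finset.sum_div, ← Finset.sum_mul,
          Λ.sum_prob, one_mul, mana_eq_log_wignerNorm _ h2]
    _ ≤ mana n ρ := by
        have := (div_le_one hN).2 (Λ.sum_wignerNorm_branch_le ρ.1 h2)
        linarith

theorem mana_tensor {n l : ℕ} (ρ : QState d n) (σ : QState d l) (h2 : (2 : ZMod d) ≠ 0) :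
    mana (n + l) (ρ.tensor σ) = mana n ρ + mana l σ := by
  rw [mana_eq_log_wignerNorm _ h2, mana_eq_log_wignerNorm _ h2, mana_eq_log_wignerNorm _ h2,
    ← Real.log_mul (one_pos.trans_le (one_le_wignerNorm ρ h2)).ne'
      (one_pos.trans_le (one_le_wignerNorm σ h2)).ne', ← wignerNorm_tensorOp _ _ h2]
  rfl

end Monotone

theorem mainTheorem2 (d : ℕ) [Fact d.Prime] (hd : Odd d) :
    IsMagicMonotone (d := d) mana ∧
    (∀ (n : ℕ) (ρ : QState d n), mana n ρ = Real.log (2 * sumNegativity ρ + 1)) ∧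
    (∀ (n m : ℕ) (ρ : QState d n) (σ : QState d m),
      mana (n + m) (ρ.tensor σ) = mana n ρ + mana m σ) := by
  have h2 := ZMod.two_ne_zero_of_odd hd
  exact ⟨isMagicMonotone_mana h2, fun n ρ => by rw [mana, sum_abs_wigner ρ h2],
    fun n m ρ σ => mana_tensor ρ σ h2⟩
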